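/- An absolute-valued real algebra is a real vector space $A$ with an $\mathbb R$-bilinear product (not assumed associative, commutative or unital) and a norm such that $\|xy\|=\|x\|\,\|y\|$ for all $x,y\in A$. Write $(x,y,z)=(xy)z-x(yz)$ and $x^2=xx$. For quaternions $a,b$ of norm one, let ${}^*\mathbb H(a,b)$ be the real vector space $\mathbb H$ of quaternions with the product $x\odot y=\overline{x}\,a\,y\,b$, and let ${}^*\mathbb H={}^*\mathbb H(1,1)$, whose product is $x\odot y=\overline{x}\,y$; let $i$ be the first imaginary unit of the canonical basis $\{1,i,j,k\}$ of $\mathbb H$. **Theorem 3.16.** For an absolute-valued real algebra $A$ of dimension $4$, the following are equivalent: 1. $(x^2,x^2,x)=0$ for all $x\in A$; 2. $A$ is isomorphic, as a real algebra, to $\mathbb H$, ${}^*\mathbb H$ or ${}^*\mathbb H(i,1)$. -/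

import Mathlib

open scoped Quaternion

/-- Two real algebras, neither associative nor unital in general, are isomorphic when there is a
bijective `ℝ`-linear multiplicative map between them. -/
def AlgIsomorphic (A B : Type*) [NonUnitalNonAssocRing A] [Module ℝ A]
    [NonUnitalNonAssocRing B] [Module ℝ B] : Prop :=
  ∃ f : A →ₙₐ[ℝ] B, Function.Bijective f

/-- The algebra `*ℍ(a, b)`: the real vector space `ℍ` of quaternions, with the product
`x ⊙ y = x̄ a y b`. It is a principal isotope of `ℍ` when `a` and `b` have norm one. -/
def StarIsotope (_a _b : ℍ[ℝ]) : Type := ℍ[ℝ]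

namespace StarIsotope

variable {a b : ℍ[ℝ]}

noncomputable instance : AddCommGroup (StarIsotope a b) := inferInstanceAs (AddCommGroup ℍ[ℝ])

noncomputable instance : Module ℝ (StarIsotope a b) := inferInstanceAs (Module ℝ ℍ[ℝ])

/-- The identity map from the vector space underlying `*ℍ(a, b)` to `ℍ`. -/
noncomputable def toQuaternion : StarIsotope a b ≃ₗ[ℝ] ℍ[ℝ] := LinearEquiv.refl ℝ ℍ[ℝ]

noncomputable instance : Mul (StarIsotope a b) where
  mul x y := toQuaternion.symm (star (toQuaternion x) * a * toQuaternion y * b)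

theorem toQuaternion_mul (x y : StarIsotope a b) :
    toQuaternion (x * y) = star (toQuaternion x) * a * toQuaternion y * b := rfl

noncomputable instance : NonUnitalNonAssocRing (StarIsotope a b) where
  left_distrib x y z := toQuaternion.injective (by
    simp only [toQuaternion_mul, map_add, mul_add, add_mul])
  right_distrib x y z := toQuaternion.injective (by
    simp only [toQuaternion_mul, map_add, star_add, add_mul])
  zero_mul x := toQuaternion.injective (by simp [toQuaternion_mul])
  mul_zero x := toQuaternion.injective (by simp [toQuaternion_mul])

end StarIsotope

/-- The standard isotope `*ℍ`: the vector space `ℍ` with the product `x ⊙ y = x̄ y`,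
which is `*ℍ(1, 1)`. -/
abbrev StarQuaternion : Type := StarIsotope 1 1

theorem StarQuaternion.toQuaternion_mul (x y : StarQuaternion) :
    StarIsotope.toQuaternion (x * y) =
      star (StarIsotope.toQuaternion x) * StarIsotope.toQuaternion y := by
  simp [StarIsotope.toQuaternion_mul]

/-- The first imaginary unit `i` of the canonical basis `1, i, j, k` of `ℍ`. -/
def quaternionI : ℍ[ℝ] := ⟨0, 1, 0, 0⟩

/-! The norm of `A` is Euclidean: for `x ≠ 0` the operator `L_x⁻¹ L_y` has an invariant line or
plane, on which its real combinations with the identity scale norms, so the span of `x` and `y` is a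
Euclidean line or plane (`parallelogram_of_norm_mul`). Dividing the product by left multiplication
by a unit vector creates a left unit; the Clifford relations then identify `A` with `ℍ` under a
product `f(x) g(y)`, with `f` and `g` isometries (`Quaternion.exists_linearEquiv_isotope`).

Each isometry of `ℍ` is `a x b` or `a x̄ b` with unit `a`, `b`, so up to a change of coordinates
four families remain: `a x y b`, `x̄ a y b`, `a x b ȳ` and `a x̄ ȳ b`. On unit quaternions
conjugation is inversion, so `(x², x², x) = 0` becomes an equation between group words, which is
tested at a few well-chosen `x`. The first family is left with `a, b = ±1`, the second, once `a` is
conjugated into the span of `1` and `i`, with `b = ±1` and `a ∈ {±1, ±i}`; the other two are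
impossible. The signs disappear under `x ↦ -x`. -/

/-! ### Absolute-valued norms are Euclidean. -/

open Polynomial in
/-- An endomorphism of a nontrivial finite-dimensional real space has an invariant line or an
invariant plane on which it acts as a non-real complex number. -/
theorem Module.End.exists_real_or_complex_eigenvector {V : Type*} [AddCommGroup V] [Module ℝ V]
    [FiniteDimensional ℝ V] [Nontrivial V] (S : Module.End ℝ V) :
    (∃ (r : ℝ) (v : V), v ≠ 0 ∧ S v = r • v) ∨
      ∃ (z : ℂ) (v : V), z.im ≠ 0 ∧ v ≠ 0 ∧
        S (S v) = (2 * z.re) • S v - (z.re ^ 2 + z.im ^ 2) • v := by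
  have hint : IsIntegral ℝ S := Algebra.IsIntegral.isIntegral S
  -- A nonconstant factor `d` of the minimal polynomial has a kernel vector: the cofactor `r` has
  -- smaller degree, so `r(S) ≠ 0`, and `d(S)` kills its image.
  have hkill : ∀ d : ℝ[X], d ∣ minpoly ℝ S → 0 < d.natDegree →
      ∃ v : V, v ≠ 0 ∧ aeval S d v = 0 := by
    rintro d ⟨r, hr⟩ hd
    have hne := minpoly.ne_zero hint
    have hr0 : r ≠ 0 := by rintro rfl; simp [hr] at hne
    have hd0 : d ≠ 0 := by rintro rfl; simp at hd
    have hrS : aeval S r ≠ 0 := by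
      intro h
      have h1 := natDegree_le_of_dvd (minpoly.dvd ℝ S h) hr0
      rw [hr, natDegree_mul hd0 hr0] at h1
      omega
    obtain ⟨y, hy⟩ : ∃ y, aeval S r y ≠ 0 := by
      by_contra! h
      exact hrS (LinearMap.ext h)
    refine ⟨aeval S r y, hy, ?_⟩
    rw [← Module.End.mul_apply, ← map_mul, ← hr, minpoly.aeval]
    rfl
  obtain ⟨z, hz⟩ : ∃ z : ℂ, aeval z (minpoly ℝ S) = 0 :=
    IsAlgClosed.exists_aeval_eq_zero _ _ (minpoly.degree_pos hint).ne'
  by_cases him : z.im = 0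
  · left
    have hdvd : X - C z.re ∣ minpoly ℝ S := by
      rw [dvd_iff_isRoot, IsRoot.def]
      have h1 : z = algebraMap ℝ ℂ z.re := Complex.ext (by simp) (by simp [him])
      rw [h1, aeval_algebraMap_apply] at hz
      simpa using hz
    obtain ⟨v, hv, h⟩ := hkill _ hdvd (by simp)
    refine ⟨z.re, v, hv, ?_⟩
    simpa [sub_eq_zero] using h
  · right
    obtain ⟨v, hv, h⟩ := hkill _ ((minpoly ℝ S).quadratic_dvd_of_aeval_eq_zero_im_ne_zero hz him)
      (by
        have : (X ^ 2 - C (2 * z.re) * X + C (‖z‖ ^ 2) : ℝ[X]).natDegree = 2 := by compute_degree!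
        omega)
    refine ⟨z, v, him, hv, ?_⟩
    have hn : ‖z‖ ^ 2 = z.re ^ 2 + z.im ^ 2 := by
      rw [← Complex.normSq_eq_norm_sq, Complex.normSq_apply]; ring
    rw [hn] at h
    simp only [map_add, map_sub, map_mul, aeval_X, aeval_C, LinearMap.add_apply,
      LinearMap.sub_apply, Module.End.mul_apply, pow_two, Module.algebraMap_end_apply] at h
    linear_combination (norm := module) h

/-- A multiplicative, absolutely homogeneous and subadditive function on `ℂ` is the modulus. -/
theorem Complex.eq_norm_of_mul_of_subadditive (N : ℂ → ℝ) (hnonneg : ∀ z, 0 ≤ N z)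
    (hmul : ∀ z w, N (z * w) = N z * N w) (hreal : ∀ r : ℝ, N r = |r|)
    (hadd : ∀ z w, N (z + w) ≤ N z + N w) (z : ℂ) : N z = ‖z‖ := by
  have hpow : ∀ (w : ℂ) (n : ℕ), N (w ^ n) = N w ^ n := by
    intro w n
    induction n with
    | zero => simpa using hreal 1
    | succ n ih => rw [pow_succ, hmul, ih, pow_succ]
  have hbound : ∀ w : ℂ, ‖w‖ = 1 → N w ≤ 1 + N Complex.I := by
    intro w hw
    have h1 := hadd w.re (w.im * Complex.I)
    rw [Complex.re_add_im, hmul, hreal, hreal] at h1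
    have h2 := Complex.abs_re_le_norm w
    have h3 := Complex.abs_im_le_norm w
    rw [hw] at h2 h3
    nlinarith [hnonneg Complex.I]
  -- `N` is bounded on the unit circle, so the powers of `w` exclude `N w > 1`; applying this to
  -- `w⁻¹` also excludes `N w < 1`.
  have hle : ∀ w : ℂ, ‖w‖ = 1 → N w ≤ 1 := by
    intro w hw
    by_contra! hlt
    obtain ⟨n, hn⟩ := pow_unbounded_of_one_lt (1 + N Complex.I) hlt
    have := hbound (w ^ n) (by simp [hw])
    rw [hpow] at this
    linarith
  have hone : ∀ w : ℂ, ‖w‖ = 1 → N w = 1 := by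
    intro w hw
    have h1 := hle w hw
    have h2 := hle w⁻¹ (by simp [hw])
    have hw0 : w ≠ 0 := by rintro rfl; simp at hw
    have h3 : N w * N w⁻¹ = 1 := by
      rw [← hmul, mul_inv_cancel₀ hw0]; simpa using hreal 1
    nlinarith [hnonneg w, hnonneg w⁻¹]
  rcases eq_or_ne z 0 with rfl | hz
  · simpa using hreal 0
  have hz' : (‖z‖ : ℂ) ≠ 0 := by simpa using hz
  have h1 : z = (‖z‖ : ℝ) * (z / ‖z‖) := by field_simp
  rw [h1, hmul, hreal, hone _ (by simp [hz])]
  simp [hz]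

/-- The norm of a finite-dimensional absolute-valued real algebra satisfies the parallelogram
law. -/
theorem parallelogram_of_norm_mul {A : Type*} [NormedAddCommGroup A] [NormedSpace ℝ A]
    [FiniteDimensional ℝ A] (m : A →ₗ[ℝ] A →ₗ[ℝ] A) (hm : ∀ x y, ‖m x y‖ = ‖x‖ * ‖y‖) (x y : A) :
    ‖x + y‖ * ‖x + y‖ + ‖x - y‖ * ‖x - y‖ = 2 * (‖x‖ * ‖x‖ + ‖y‖ * ‖y‖) := by
  rcases eq_or_ne x 0 with rfl | hx
  · simp; ring
  have hx' : ‖x‖ ≠ 0 := norm_ne_zero_iff.2 hx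
  have : Nontrivial A := ⟨x, 0, hx⟩
  have hinj : Function.Injective (m x) := by
    rw [injective_iff_map_eq_zero]
    intro a ha
    have := hm x a
    rw [ha, norm_zero, eq_comm, mul_eq_zero] at this
    simpa [hx'] using this
  let Lx : A ≃ₗ[ℝ] A := LinearEquiv.ofInjectiveEndo (m x) hinj
  have hLx : ∀ a, Lx a = m x a := fun a => rfl
  let S : Module.End ℝ A := Lx.symm.toLinearMap ∘ₗ m y
  have hS : ∀ a, m x (S a) = m y a := fun a => by
    rw [← hLx]; exact Lx.apply_symm_apply _
  -- Both sides are the norm of `(s x + t y) v`.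
  have hsim : ∀ (s t : ℝ) (v : A), ‖x‖ * ‖s • v + t • S v‖ = ‖s • x + t • y‖ * ‖v‖ := by
    intro s t v
    rw [← hm, ← hm]
    simp [hS]
  rcases S.exists_real_or_complex_eigenvector with ⟨r, v, hv, h⟩ | ⟨z, v, hz, hv, h⟩
  · have h1 := hsim (-r) 1 v
    have h2 : -r • v + (1 : ℝ) • S v = 0 := by rw [h]; module
    rw [h2, norm_zero, mul_zero, eq_comm, mul_eq_zero, norm_eq_zero] at h1
    have h3 : y = r • x := by
      have := h1.resolve_right (norm_ne_zero_iff.2 hv)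
      linear_combination (norm := module) this
    have e1 : x + y = (1 + r) • x := by rw [h3]; module
    have e2 : x - y = (1 - r) • x := by rw [h3]; module
    rw [e1, e2, h3]
    simp only [norm_smul, Real.norm_eq_abs]
    linear_combination ‖x‖ ^ 2 * abs_mul_abs_self (1 + r) + ‖x‖ ^ 2 * abs_mul_abs_self (1 - r)
      - 2 * ‖x‖ ^ 2 * abs_mul_abs_self r
  · have hv' : ‖v‖ ≠ 0 := norm_ne_zero_iff.2 hv
    let y' : A := z.im⁻¹ • (y - z.re • x)
    let J : Module.End ℝ A := z.im⁻¹ • (S - z.re • 1)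
    have hy : y = z.re • x + z.im • y' := by
      simp only [y', smul_smul, mul_inv_cancel₀ hz]; module
    have hJsim : ∀ (s t : ℝ) (v : A), ‖x‖ * ‖s • v + t • J v‖ = ‖s • x + t • y'‖ * ‖v‖ := by
      intro s t v
      have := hsim (s - t * z.im⁻¹ * z.re) (t * z.im⁻¹) v
      convert this using 3
      · simp [J]; module
      · simp [y']; module
    have hJJ : J (J v) = -v := by
      have : z.im ^ 2 • (J (J v) + v) = 0 := by
        simp only [J, LinearMap.smul_apply, LinearMap.sub_apply, map_smul, map_sub,
          Module.End.one_apply, h]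
        match_scalars <;> field_simp <;> ring
      rw [smul_eq_zero_iff_right (pow_ne_zero 2 hz)] at this
      exact eq_neg_of_add_eq_zero_left this
    -- `N w` is the factor by which `w.re + w.im J` scales norms. On the span of `v` and `J v` these
    -- operators compose as complex numbers, so `N` is multiplicative and hence the modulus.
    let N : ℂ → ℝ := fun w => ‖w.re • x + w.im • y'‖ / ‖x‖
    have hN : ∀ (w : ℂ) (u : A), ‖w.re • u + w.im • J u‖ = N w * ‖u‖ := by
      intro w u
      simp only [N]
      rw [div_mul_eq_mul_div, ← hJsim]; field_simp
    have hNnorm : ∀ w, N w = ‖w‖ := by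
      apply Complex.eq_norm_of_mul_of_subadditive
      · intro w; positivity
      · intro a b
        have h1 := hN (a * b) v
        have h2 : (a * b).re • v + (a * b).im • J v =
            a.re • (b.re • v + b.im • J v) + a.im • J (b.re • v + b.im • J v) := by
          simp only [map_add, map_smul, hJJ, Complex.mul_re, Complex.mul_im]
          module
        rw [h2, hN, hN, ← mul_assoc] at h1
        exact (mul_right_cancel₀ hv' h1).symm
      · intro r
        simp [N, norm_smul, hx']
      · intro a b
        simp only [N, ← add_div]
        gcongr
        refine le_trans (le_of_eq ?_) (norm_add_le _ _)
        congr 1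
        simp only [Complex.add_re, Complex.add_im]
        module
    have hfin : ∀ w : ℂ, ‖w.re • x + w.im • y'‖ * ‖w.re • x + w.im • y'‖ =
        ‖x‖ ^ 2 * (w.re ^ 2 + w.im ^ 2) := by
      intro w
      have : ‖w.re • x + w.im • y'‖ = ‖w‖ * ‖x‖ := by
        rw [← hNnorm]; simp only [N]; field_simp
      have hn : ‖w‖ ^ 2 = w.re ^ 2 + w.im ^ 2 := by
        rw [← Complex.normSq_eq_norm_sq, Complex.normSq_apply]; ring
      rw [this, ← hn]; ring
    have h1 := hfin (1 + z)
    have h2 := hfin (1 - z)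
    have h3 := hfin z
    have e1 : (1 + z).re • x + (1 + z).im • y' = x + y := by
      rw [hy]; simp only [Complex.add_re, Complex.add_im, Complex.one_re, Complex.one_im]; module
    have e2 : (1 - z).re • x + (1 - z).im • y' = x - y := by
      rw [hy]; simp only [Complex.sub_re, Complex.sub_im, Complex.one_re, Complex.one_im]; module
    rw [e1] at h1
    rw [e2] at h2
    rw [← hy] at h3
    rw [h1, h2, h3]
    simp
    ring

/-- A four-dimensional absolute-valued real algebra is linearly isometric to the quaternions. -/
theorem exists_linearEquiv_quaternion_norm_mul {A : Type*} [AddCommGroup A] [Module ℝ A] [Norm A]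
    (hnorm : NormedSpace.Core ℝ A) (hdim : Module.finrank ℝ A = 4)
    (m : A →ₗ[ℝ] A →ₗ[ℝ] A) (hm : ∀ x y, ‖m x y‖ = ‖x‖ * ‖y‖) :
    ∃ E : A ≃ₗ[ℝ] ℍ[ℝ], ∀ x, ‖E x‖ = ‖x‖ := by
  let _ : NormedAddCommGroup A := NormedAddCommGroup.ofCore hnorm
  let _ : NormedSpace ℝ A := NormedSpace.ofCore hnorm
  have : FiniteDimensional ℝ A := Module.finite_of_finrank_pos (by omega)
  let _ : InnerProductSpace ℝ A := InnerProductSpace.ofNorm ℝ (parallelogram_of_norm_mul m hm)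
  let e : A ≃ₗᵢ[ℝ] ℍ[ℝ] := ((stdOrthonormalBasis ℝ A).reindex (finCongr hdim)).repr.trans
    Quaternion.linearIsometryEquivTuple.symm
  exact ⟨e.toLinearEquiv, e.norm_map⟩

/-! ### Orthogonal transformations of the quaternions. -/

/-- Every orthogonal transformation of the quaternions is `x ↦ a x b` or `x ↦ a x̄ b` with `a` and
`b` of norm one. -/
theorem Quaternion.linearIsometryEquiv_eq_mul_mul (f : ℍ[ℝ] ≃ₗᵢ[ℝ] ℍ[ℝ]) :
    ∃ a b : ℍ[ℝ], ‖a‖ = 1 ∧ ‖b‖ = 1 ∧ ((∀ x, f x = a * x * b) ∨ ∀ x, f x = a * star x * b) := by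
  obtain ⟨l, -, rfl⟩ := f.reflections_generate_dim
  induction l with
  | nil => exact ⟨1, 1, by simp, by simp, Or.inl fun x => by simp⟩
  | cons v l ih =>
    obtain ⟨a, b, ha, hb, h⟩ := ih
    simp only [List.map_cons, List.prod_cons, LinearIsometryEquiv.coe_mul, Function.comp_apply]
    -- The generating list may contain the zero vector, whose reflection is the identity.
    rcases eq_or_ne v 0 with rfl | hv
    · have h0 : ∀ y : ℍ[ℝ], (Submodule.span ℝ {(0 : ℍ[ℝ])})ᗮ.reflection y = y := fun y => by
        rw [Submodule.reflection_orthogonal_apply, Submodule.reflection_singleton_apply]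
        simp
      exact ⟨a, b, ha, hb, by simpa only [h0] using h⟩
    have hv' : ‖v‖ ≠ 0 := norm_ne_zero_iff.2 hv
    obtain ⟨u, hu, hrefl⟩ : ∃ u : ℍ[ℝ], ‖u‖ = 1 ∧
        ∀ x, (Submodule.span ℝ {v})ᗮ.reflection x = -u * star x * u := by
      refine ⟨(‖v‖⁻¹ : ℝ) • v, by simp [norm_smul, hv'], fun x => ?_⟩
      rw [Submodule.reflection_orthogonal_apply, Submodule.reflection_singleton_apply,
        Quaternion.inner_def]
      have hn : ‖v‖ ^ 2 = v.re ^ 2 + v.imI ^ 2 + v.imJ ^ 2 + v.imK ^ 2 := by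
        rw [pow_two, ← Quaternion.normSq_eq_norm_mul_self, Quaternion.normSq_def']
      -- The identity `v x̄ v = 2⟨v, x⟩ v - ‖v‖² x` expresses the reflection by conjugation, so each
      -- further reflection swaps the two forms.
      have key : ‖v‖ ^ 2 • x - (2 * (v * star x).re) • v = - (v * star x * v) := by
        rw [hn]
        ext <;> simp <;> ring
      have h2 : -((‖v‖⁻¹ : ℝ) • v) * star x * ((‖v‖⁻¹ : ℝ) • v)
          = (‖v‖ ^ 2)⁻¹ • -(v * star x * v) := by
        simp only [neg_mul, smul_mul_assoc, mul_smul_comm, smul_smul, smul_neg]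
        congr 2; field_simp
      rw [h2, ← key]
      match_scalars <;> simp <;> field_simp
    simp only [hrefl]
    rcases h with h | h
    · refine ⟨-u * star b, star a * u, ?_, ?_, Or.inr fun x => ?_⟩
      · simp [hu, hb]
      · simp [hu, ha]
      · rw [h]; simp only [star_mul, mul_assoc]
    · refine ⟨-u * star b, star a * u, ?_, ?_, Or.inl fun x => ?_⟩
      · simp [hu, hb]
      · simp [hu, ha]
      · rw [h]; simp only [star_mul, star_star, mul_assoc]

/-! ### Clifford relations and the isotopy with `ℍ`. -/

section NormMul

variable {V W : Type*} [NormedAddCommGroup V] [InnerProductSpace ℝ V]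
  [NormedAddCommGroup W] [InnerProductSpace ℝ W] {T : V →ₗ[ℝ] W →ₗ[ℝ] W}

open scoped RealInnerProductSpace

/-- Polarisation in the first variable of the square of the norm identity. -/
theorem inner_apply_apply_left (hT : ∀ x y, ‖T x y‖ = ‖x‖ * ‖y‖) (x x' : V) (y : W) :
    ⟪T x y, T x' y⟫ = ⟪x, x'⟫ * ‖y‖ ^ 2 := by
  have h := hT (x + x') y
  have h2 := congrArg (· ^ 2) h
  simp only [map_add, LinearMap.add_apply, mul_pow, norm_add_sq_real, hT] at h2
  linarith

/-- If `T e = 1` then `T x` squares to a negative scalar when `x` is orthogonal to `e`. -/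
theorem apply_apply_of_inner_eq_zero (hT : ∀ x y, ‖T x y‖ = ‖x‖ * ‖y‖) {e : V}
    (he : T e = LinearMap.id) {x : V} (hx : ⟪e, x⟫ = 0) (y : W) :
    T x (T x y) = -(‖x‖ ^ 2) • y := by
  have hskew : ∀ y, ⟪y, T x y⟫ = 0 := fun y => by
    have := inner_apply_apply_left hT e x y
    rwa [he, hx, zero_mul] at this
  have h1 := hskew (y + T x y)
  simp only [map_add, inner_add_left, inner_add_right, hskew, real_inner_self_eq_norm_sq, hT] at h1
  -- As `T x` is skew, expanding this square leaves `‖x‖⁴‖y‖² - 2‖x‖⁴‖y‖² + ‖x‖⁴‖y‖² = 0`.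
  have h2 : ‖T x (T x y) + (‖x‖ ^ 2) • y‖ ^ 2 = 0 := by
    rw [norm_add_sq_real, hT, hT, norm_smul, inner_smul_right, real_inner_comm]
    simp only [norm_pow, norm_norm]
    linear_combination 2 * ‖x‖ ^ 2 * h1
  rw [sq_eq_zero_iff, norm_eq_zero] at h2
  rw [neg_smul]
  exact eq_neg_of_add_eq_zero_left h2

/-- Linearisation of the previous lemma; for orthogonal arguments it says that the operators
anticommute. -/
theorem apply_apply_add_apply_apply (hT : ∀ x y, ‖T x y‖ = ‖x‖ * ‖y‖) {e : V}
    (he : T e = LinearMap.id) {x x' : V} (hx : ⟪e, x⟫ = 0) (hx' : ⟪e, x'⟫ = 0) (y : W) :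
    T x (T x' y) + T x' (T x y) = -(2 * ⟪x, x'⟫) • y := by
  have h := apply_apply_of_inner_eq_zero hT he (x := x + x') (by rw [inner_add_right, hx, hx']; simp) y
  simp only [map_add, LinearMap.add_apply, apply_apply_of_inner_eq_zero hT he hx,
    apply_apply_of_inner_eq_zero hT he hx', norm_add_sq_real] at h
  linear_combination (norm := module) h

end NormMul

/-- For anticommuting square roots `i, j, k` of `-1` in a ring, `k i j` is an involution commuting
with `i` and `j`. -/
theorem anticommuting_triple {R : Type*} [Ring R] {i j k : R} (hi : i * i = -1) (hj : j * j = -1)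
    (hk : k * k = -1) (hji : j * i = -(i * j)) (hki : k * i = -(i * k)) (hkj : k * j = -(j * k)) :
    Commute (k * (i * j)) i ∧ Commute (k * (i * j)) j ∧ k * (i * j) * (k * (i * j)) = 1 ∧
      k * (i * j) * (i * j) = -k := by
  have hi' : ∀ x, i * (i * x) = -x := fun x => by rw [← mul_assoc, hi, neg_one_mul]
  have hj' : ∀ x, j * (j * x) = -x := fun x => by rw [← mul_assoc, hj, neg_one_mul]
  have hji' : ∀ x, j * (i * x) = -(i * (j * x)) := fun x => by
    rw [← mul_assoc, hji, neg_mul, mul_assoc]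
  have hki' : ∀ x, k * (i * x) = -(i * (k * x)) := fun x => by
    rw [← mul_assoc, hki, neg_mul, mul_assoc]
  have hkj' : ∀ x, k * (j * x) = -(j * (k * x)) := fun x => by
    rw [← mul_assoc, hkj, neg_mul, mul_assoc]
  refine ⟨?_, ?_, ?_, ?_⟩ <;>
    simp [commute_iff_eq, mul_assoc, hi, hj, hk, hki, hkj, hi', hj', hji', hki', hkj']

namespace Quaternion

/-- A Hurwitz-type normal form: a bilinear product on `ℍ` that multiplies norms and has `1` as a
left unit is an isotope of the product of `ℍ`. -/
theorem exists_isotopy_of_left_unit (T : ℍ[ℝ] →ₗ[ℝ] ℍ[ℝ] →ₗ[ℝ] ℍ[ℝ])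
    (hT : ∀ x y, ‖T x y‖ = ‖x‖ * ‖y‖) (hone : T 1 = LinearMap.id) :
    ∃ φ V : ℍ[ℝ] ≃ₗᵢ[ℝ] ℍ[ℝ], ∀ x y, T x (V y) = V (φ x * y) := by
  obtain ⟨qi, i0, i1, i2, i3⟩ : ∃ q : ℍ[ℝ], q.re = 0 ∧ q.imI = 1 ∧ q.imJ = 0 ∧ q.imK = 0 :=
    ⟨⟨0, 1, 0, 0⟩, rfl, rfl, rfl, rfl⟩
  obtain ⟨qj, j0, j1, j2, j3⟩ : ∃ q : ℍ[ℝ], q.re = 0 ∧ q.imI = 0 ∧ q.imJ = 1 ∧ q.imK = 0 :=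
    ⟨⟨0, 0, 1, 0⟩, rfl, rfl, rfl, rfl⟩
  obtain ⟨qk, k0, k1, k2, k3⟩ : ∃ q : ℍ[ℝ], q.re = 0 ∧ q.imI = 0 ∧ q.imJ = 0 ∧ q.imK = 1 :=
    ⟨⟨0, 0, 0, 1⟩, rfl, rfl, rfl, rfl⟩
  have norm_eq : ∀ q : ℍ[ℝ], ‖q‖ ^ 2 = q.re ^ 2 + q.imI ^ 2 + q.imJ ^ 2 + q.imK ^ 2 := fun q => by
    rw [pow_two, ← normSq_eq_norm_mul_self, normSq_def']
  have hsq : ∀ q : ℍ[ℝ], q.re = 0 → ‖q‖ ^ 2 = 1 → T q * T q = -1 := by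
    intro q h0 h1
    ext1 y
    have := apply_apply_of_inner_eq_zero hT hone (x := q) (by simp [inner_def, h0]) y
    rw [h1] at this
    simpa using this
  have hac : ∀ q r : ℍ[ℝ], q.re = 0 → r.re = 0 → inner ℝ q r = 0 → T q * T r = -(T r * T q) := by
    intro q r h0 h1 h2
    ext1 y
    have := apply_apply_add_apply_apply hT hone (x := q) (x' := r)
      (by simp [inner_def, h0]) (by simp [inner_def, h1]) y
    rw [h2] at this
    simpa using eq_neg_of_add_eq_zero_left (this.trans (by simp))
  have hi : T qi * T qi = -1 := hsq _ i0 (by rw [norm_eq]; simp [i0, i1, i2, i3])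
  have hj : T qj * T qj = -1 := hsq _ j0 (by rw [norm_eq]; simp [j0, j1, j2, j3])
  have hk : T qk * T qk = -1 := hsq _ k0 (by rw [norm_eq]; simp [k0, k1, k2, k3])
  have hij : T qj * T qi = -(T qi * T qj) := hac _ _ j0 i0 (by
    simp [inner_def, i0, i1, i2, i3, j0, j1, j2, j3])
  have hik : T qk * T qi = -(T qi * T qk) := hac _ _ k0 i0 (by
    simp [inner_def, i0, i1, i2, i3, k0, k1, k2, k3])
  have hjk : T qk * T qj = -(T qj * T qk) := hac _ _ k0 j0 (by
    simp [inner_def, j0, j1, j2, j3, k0, k1, k2, k3])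
  let B : QuaternionAlgebra.Basis (Module.End ℝ ℍ[ℝ]) (-1 : ℝ) 0 (-1) :=
    { i := T qi, j := T qj, k := T qi * T qj
      i_mul_i := by rw [hi]; simp
      j_mul_j := by rw [hj]; simp
      i_mul_j := rfl
      j_mul_i := by rw [hij]; simp }
  let ρ : ℍ[ℝ] →ₐ[ℝ] Module.End ℝ ℍ[ℝ] := B.liftHom
  have hρ : ∀ q : ℍ[ℝ], ρ q =
      q.re • 1 + q.imI • T qi + q.imJ • T qj + q.imK • (T qi * T qj) := fun q => by
    change B.lift q = _
    simp only [QuaternionAlgebra.Basis.lift, Algebra.algebraMap_eq_smul_one]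
    rfl
  have hTq : ∀ q : ℍ[ℝ], T q = q.re • 1 + q.imI • T qi + q.imJ • T qj + q.imK • T qk := by
    intro q
    have : q = q.re • 1 + q.imI • qi + q.imJ • qj + q.imK • qk := by
      ext <;> simp [i0, i1, i2, i3, j0, j1, j2, j3, k0, k1, k2, k3]
    conv_lhs => rw [this]
    simp only [map_add, map_smul, hone]
    rfl
  let v : ℍ[ℝ] →ₗ[ℝ] ℍ[ℝ] := (LinearMap.applyₗ (1 : ℍ[ℝ])) ∘ₗ ρ.toLinearMap
  have hv : ∀ q, v q = ρ q 1 := fun q => rfl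
  have hvmul : ∀ p q, v (p * q) = ρ p (v q) := fun p q => by simp [hv]
  -- Each nonzero `q` acts invertibly through `ρ`, so `ℍ` is a free module of rank one over itself,
  -- generated by `1`.
  have hinj : Function.Injective v := by
    rw [injective_iff_map_eq_zero]
    intro q hq
    by_contra h0
    have h1 := hvmul q⁻¹ q
    rw [hq, map_zero, inv_mul_cancel₀ h0, hv, map_one ρ] at h1
    exact one_ne_zero (α := ℍ[ℝ]) h1
  have hsurj : Function.Surjective v := LinearMap.surjective_of_injective hinj
  -- `T qk` is, up to sign, the product of `T qi` and `T qj`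
  let M : Module.End ℝ ℍ[ℝ] := T qk * (T qi * T qj)
  obtain ⟨hMi, hMj, hMM, hMk⟩ := anticommuting_triple hi hj hk hij hik hjk
  change M * T qi = T qi * M at hMi
  change M * T qj = T qj * M at hMj
  change M * M = 1 at hMM
  change M * (T qi * T qj) = -T qk at hMk
  have hMρ : ∀ q, M * ρ q = ρ q * M := by
    intro q
    simp only [hρ, mul_add, add_mul, mul_smul_comm, smul_mul_assoc, mul_one, one_mul, hMi, hMj]
    rw [← mul_assoc M, hMi, mul_assoc, hMj, mul_assoc]
  -- Since `M` commutes with `ρ`, it becomes right multiplication by some `r` under `v`. Then `M² =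
  -- 1` gives `r² = 1`, so `r = ±1` in a division ring.
  obtain ⟨r, hr⟩ := hsurj (M 1)
  have hMv : ∀ q, M (v q) = v (q * r) := by
    intro q
    rw [hvmul, hr, hv, ← Module.End.mul_apply, hMρ]
    rfl
  have hrr : r * r = 1 := by
    apply hinj
    rw [← hMv, hr, ← Module.End.mul_apply, hMM, hv, map_one ρ]
  obtain ⟨ε, hε, hMε⟩ : ∃ ε : ℝ, ε * ε = 1 ∧ M = ε • 1 := by
    rcases mul_self_eq_one_iff.1 hrr with rfl | rfl
    · refine ⟨1, by norm_num, LinearMap.ext fun y => ?_⟩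
      obtain ⟨q, rfl⟩ := hsurj y
      rw [hMv]; simp
    · refine ⟨-1, by norm_num, LinearMap.ext fun y => ?_⟩
      obtain ⟨q, rfl⟩ := hsurj y
      rw [hMv]; simp
  have hTk : T qk = (-ε) • (T qi * T qj) := by
    rw [hMε] at hMk
    rw [smul_mul_assoc, one_mul] at hMk
    exact (neg_eq_iff_eq_neg.2 hMk).symm.trans (neg_smul ε (T qi * T qj : Module.End ℝ ℍ[ℝ])).symm
  -- Changing the sign of the `k` coordinate if necessary absorbs the sign in `T qk = ±T qi T qj`.
  obtain ⟨φ₀, h0, h1, h2, h3⟩ : ∃ φ₀ : ℍ[ℝ] →ₗ[ℝ] ℍ[ℝ], (∀ q, (φ₀ q).re = q.re) ∧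
      (∀ q, (φ₀ q).imI = q.imI) ∧ (∀ q, (φ₀ q).imJ = q.imJ) ∧ ∀ q, (φ₀ q).imK = -ε * q.imK :=
    ⟨{ toFun := fun q => ⟨q.re, q.imI, q.imJ, -ε * q.imK⟩
       map_add' := fun x y => Quaternion.ext _ _ rfl rfl rfl (mul_add _ _ _)
       map_smul' := fun c x => Quaternion.ext _ _ rfl rfl rfl (mul_left_comm _ _ _) },
      fun q => rfl, fun q => rfl, fun q => rfl, fun q => rfl⟩
  have hφ₀ : ∀ q, ‖φ₀ q‖ = ‖q‖ := by
    intro q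
    rw [← sq_eq_sq₀ (norm_nonneg _) (norm_nonneg _), norm_eq, norm_eq, h0, h1, h2, h3]
    linear_combination q.imK ^ 2 * hε
  let φ : ℍ[ℝ] ≃ₗᵢ[ℝ] ℍ[ℝ] := LinearIsometry.toLinearIsometryEquiv ⟨φ₀, hφ₀⟩ rfl
  have hφ : ∀ q, φ q = φ₀ q := fun q => rfl
  have hTφ : ∀ q, T q = ρ (φ q) := by
    intro q
    rw [hTq, hρ, hTk, smul_smul, hφ, h0, h1, h2, h3, mul_comm (-ε)]
  have hvn : ∀ q, ‖v q‖ = ‖q‖ := by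
    intro q
    obtain ⟨p, rfl⟩ := φ.surjective q
    rw [hv, ← hTφ, hT, φ.norm_map, norm_one, mul_one]
  refine ⟨φ, LinearIsometry.toLinearIsometryEquiv ⟨v, hvn⟩ rfl, fun x y => ?_⟩
  change T x (v y) = v (φ x * y)
  rw [hvmul, hTφ]

/-- A real algebra structure on a space linearly isometric to `ℍ` whose product multiplies norms is
isomorphic to an isotope of `ℍ` by two isometries. -/
theorem exists_linearEquiv_isotope {A : Type*} [AddCommGroup A] [Module ℝ A]
    (m : A →ₗ[ℝ] A →ₗ[ℝ] A) (E : A ≃ₗ[ℝ] ℍ[ℝ])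
    (hm : ∀ x y, ‖E (m x y)‖ = ‖E x‖ * ‖E y‖) :
    ∃ (f g : ℍ[ℝ] ≃ₗᵢ[ℝ] ℍ[ℝ]) (F : A ≃ₗ[ℝ] ℍ[ℝ]), ∀ x y, F (m x y) = f (F x) * g (F y) := by
  -- Left multiplication by a unit vector is an isometry; composing the product with its inverse
  -- makes that vector a left unit.
  let l : ℍ[ℝ] →ₗ[ℝ] ℍ[ℝ] := E.toLinearMap ∘ₗ m (E.symm 1) ∘ₗ E.symm.toLinearMap
  let L : ℍ[ℝ] ≃ₗᵢ[ℝ] ℍ[ℝ] := LinearIsometry.toLinearIsometryEquiv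
    ⟨l, fun x => by simp [l, hm]⟩ rfl
  have hL : ∀ x, L x = E (m (E.symm 1) (E.symm x)) := fun x => rfl
  let T : ℍ[ℝ] →ₗ[ℝ] ℍ[ℝ] →ₗ[ℝ] ℍ[ℝ] :=
    (m.compl₁₂ E.symm.toLinearMap E.symm.toLinearMap).compr₂
      (L.symm.toLinearEquiv.toLinearMap ∘ₗ E.toLinearMap)
  have hT : ∀ x y, L (T x y) = E (m (E.symm x) (E.symm y)) := fun x y => by
    simp [T]
  obtain ⟨φ, V, h⟩ := exists_isotopy_of_left_unit T
    (fun x y => by rw [← L.norm_map, hT, hm]; simp)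
    (LinearMap.ext fun y => L.injective (by rw [hT, ← hL]; rfl))
  let P := V.trans L
  have hP : ∀ x, P x = L (V x) := fun x => rfl
  refine ⟨P.trans φ, P.trans V.symm, E.trans P.symm.toLinearEquiv, fun x y => ?_⟩
  have h1 := h (E x) (V.symm (E y))
  apply P.injective
  simp only [LinearEquiv.trans_apply, LinearIsometryEquiv.trans_apply,
    LinearIsometryEquiv.coe_toLinearEquiv, LinearIsometryEquiv.apply_symm_apply]
  rw [hP, ← h1, LinearIsometryEquiv.apply_symm_apply, hT]
  simp

end Quaternion

/-! ### Instances of the identity as equations in a group. -/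

section GroupWords

variable {G : Type*} [Group G] {a b : G}

/-- The identity for `x̄ a y b` at `x = 1`. -/
theorem commute_of_star_left_word
    (h : ((b⁻¹ * a⁻¹ * a * (a * b) * b)⁻¹ * a * b) =
      b⁻¹ * a⁻¹ * a * (b⁻¹ * a⁻¹ * a * b) * b) : b * a = a * b :=
  calc b * a = a * b * b * ((b⁻¹ * a⁻¹ * a * (a * b) * b)⁻¹ * a * b) * b⁻¹ := by group
    _ = a * b := by rw [h]; group

/-- The identity for `x̄ a y b` at an `n` that inverts both parameters; the square of `n` is then
`a⁻¹ b`. -/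
theorem mul_self_eq_of_star_left_word (hab : b * a = a * b) {n : G} (hna : n * a = a⁻¹ * n)
    (hnb : n * b = b⁻¹ * n)
    (h : ((n⁻¹ * a * n * b)⁻¹ * a * (n⁻¹ * a * n * b) * b)⁻¹ * a * n * b =
      (n⁻¹ * a * n * b)⁻¹ * a * ((n⁻¹ * a * n * b)⁻¹ * a * n * b) * b) :
    b * b = a * a * (a * a) := by
  have hu : n⁻¹ * a * n = a⁻¹ := by
    have : n * a⁻¹ = a * n := by
      rw [mul_inv_eq_iff_eq_mul, mul_assoc, hna, mul_inv_cancel_left]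
    rw [mul_assoc, ← this, inv_mul_cancel_left]
  rw [hu] at h
  have c1 : Commute b a := hab
  have e1 : (a⁻¹ * b)⁻¹ * a * (a⁻¹ * b) * b = a * b := by
    have : Commute (a⁻¹ * b) a := (Commute.refl a).inv_left.mul_left c1
    rw [mul_assoc (a⁻¹ * b)⁻¹, ← this.eq, inv_mul_cancel_left]
  have e2 : (a⁻¹ * b)⁻¹ * a = b⁻¹ * (a * a) := by group
  have e3 : (a * b)⁻¹ * a = b⁻¹ := by group
  rw [e1, e2, e3] at h
  have c2 : Commute (b⁻¹) (a * a) := (c1.inv_left).mul_right c1.inv_left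
  have h1 := mul_right_cancel h
  rw [mul_assoc _ n b, hnb] at h1
  have h2 : b⁻¹ * (a * a) * (b⁻¹ * (a * a)) * b⁻¹ = b⁻¹ :=
    mul_right_cancel (b := n) (by rw [h1]; group)
  have h3 : b⁻¹ * b⁻¹ * (a * a * (a * a)) = 1 := by
    calc b⁻¹ * b⁻¹ * (a * a * (a * a)) = b⁻¹ * (b⁻¹ * (a * a)) * (a * a) := by group
      _ = b⁻¹ * (a * a * b⁻¹) * (a * a) := by rw [c2.eq]
      _ = b⁻¹ * (a * a) * (b⁻¹ * (a * a)) * b⁻¹ * b := by group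
      _ = 1 := by rw [h2]; group
  rw [← mul_inv_rev] at h3
  exact inv_mul_eq_one.1 h3

/-- The identity for `x̄ a y b`, with `w` the rotated copy of `a`, arranged so that `x` survives
only in the conjugate `x b x⁻¹`. -/
theorem rotation_eq_of_star_left_word {x w : G} (hw : x⁻¹ * a * x = w)
    (h : ((x⁻¹ * a * x * b)⁻¹ * a * (x⁻¹ * a * x * b) * b)⁻¹ * a * x * b =
      (x⁻¹ * a * x * b)⁻¹ * a * ((x⁻¹ * a * x * b)⁻¹ * a * x * b) * b) :
    b⁻¹ * w⁻¹ * a⁻¹ * w * b * a = w⁻¹ * a * b⁻¹ * w⁻¹ * a * (x * b * x⁻¹) := by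
  rw [hw] at h
  calc b⁻¹ * w⁻¹ * a⁻¹ * w * b * a
      = b * (((w * b)⁻¹ * a * (w * b) * b)⁻¹ * a * x * b) * b⁻¹ * x⁻¹ := by group
    _ = w⁻¹ * a * b⁻¹ * w⁻¹ * a * (x * b * x⁻¹) := by rw [h]; group

/-- The identity for `a x b ȳ` at `x = 1`, where the right-hand side collapses. -/
theorem word_eq_one_of_star_right_word
    (h : a * (a * (a * b) * b * (a * b)⁻¹) * b = a * (a * b) * b * (a * (a * b) * b)⁻¹) :
    a * a * a * b * a⁻¹ * b = 1 := by
  rw [mul_inv_cancel] at h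
  rw [← h]; group

/-- The identity for `a x b ȳ` at an `x` commuting with `b`, whose square is then `a b`. -/
theorem inv_eq_conj_of_star_right_word {x : G} (hx : x * b = b * x)
    (h1 : a * a * a * b * a⁻¹ * b = 1)
    (h : a * (a * (a * x * b * x⁻¹) * b * (a * x * b * x⁻¹)⁻¹) * b * x⁻¹ =
      a * (a * x * b * x⁻¹) * b * (a * (a * x * b * x⁻¹) * b * x⁻¹)⁻¹) :
    x⁻¹ = a * a * x * (a * a)⁻¹ := by
  have hu : a * x * b * x⁻¹ = a * b := by rw [mul_assoc a, hx]; group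
  rw [hu] at h
  calc x⁻¹ = a * a * a * b * a⁻¹ * b * x⁻¹ := by rw [h1, one_mul]
    _ = a * (a * (a * b) * b * (a * b)⁻¹) * b * x⁻¹ := by group
    _ = a * a * (b * b * x) * (b⁻¹ * b⁻¹ * a⁻¹ * a⁻¹) := by rw [h]; group
    _ = a * a * x * (a * a)⁻¹ := by rw [mul_assoc b b x, ← hx, ← mul_assoc b x b, ← hx]; group

/-- The identity for `a x b ȳ` at `x = a²` when `a²` inverts `b`, so that the square of `x` is `a
b⁻¹`. -/
theorem mul_self_inv_eq_of_star_right_word (hn : a * a * b = b⁻¹ * (a * a))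
    (h1 : a * a * a * b * a⁻¹ * b = 1)
    (h : a * (a * (a * (a * a) * b * (a * a)⁻¹) * b * (a * (a * a) * b * (a * a)⁻¹)⁻¹) * b *
        (a * a)⁻¹ = a * (a * (a * a) * b * (a * a)⁻¹) * b *
          (a * (a * (a * a) * b * (a * a)⁻¹) * b * (a * a)⁻¹)⁻¹) :
    (a * a)⁻¹ = a * a := by
  have hu : a * (a * a) * b * (a * a)⁻¹ = a * b⁻¹ := by rw [mul_assoc a, hn]; group
  rw [hu] at h
  calc (a * a)⁻¹ = a * a * a * b * a⁻¹ * b * (a * a)⁻¹ := by rw [h1, one_mul]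
    _ = a * (a * (a * b⁻¹) * b * (a * b⁻¹)⁻¹) * b * (a * a)⁻¹ := by group
    _ = a * a := by rw [h]; simp [mul_assoc]

/-- The identity for `a x̄ ȳ b` at `x = 1`. -/
theorem mul_eq_inv_mul_inv_of_star_star_word
    (h : a * (a * (a * b)⁻¹ * (a * b)⁻¹ * b)⁻¹ * b =
      a * (a * b)⁻¹ * (a * (a * b)⁻¹ * b)⁻¹ * b) : a * b = a⁻¹ * b⁻¹ :=
  calc a * b = b * a⁻¹ * (a * (a * (a * b)⁻¹ * (a * b)⁻¹ * b)⁻¹ * b) *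
        (b⁻¹ * a * b⁻¹ * a⁻¹) := by group
    _ = a⁻¹ * b⁻¹ := by rw [h]; group

/-- The identity for `a x̄ ȳ b` at a square root of `-1`, whose square in the isotope is `-ab`. -/
theorem anticommute_of_star_star_word [HasDistribNeg G] {x : G} (hx : x * x = -1)
    (h1 : a * b = a⁻¹ * b⁻¹)
    (h : a * (a * (a * x⁻¹ * x⁻¹ * b)⁻¹ * (a * x⁻¹ * x⁻¹ * b)⁻¹ * b)⁻¹ * x⁻¹ * b =
      a * (a * x⁻¹ * x⁻¹ * b)⁻¹ * (a * (a * x⁻¹ * x⁻¹ * b)⁻¹ * x⁻¹ * b)⁻¹ * b) :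
    a * b * a⁻¹ * x = -(x * (a * b * a⁻¹)) := by
  have hxi : x⁻¹ = -x := by
    rw [inv_eq_iff_mul_eq_one, mul_neg, hx, neg_neg]
  have hu : a * x⁻¹ * x⁻¹ * b = -(a * b) := by
    rw [hxi, mul_assoc a, neg_mul_neg, hx]; simp
  rw [hu] at h
  have h2 : a * b⁻¹ * (a * b) * (a * b * a⁻¹ * x⁻¹) * b =
      a * b⁻¹ * (a⁻¹ * b⁻¹) * (x * (a * b * a⁻¹)) * b := by
    convert h using 1
    · simp only [inv_neg, mul_neg, neg_mul, neg_neg]; group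
    · simp only [inv_neg, mul_neg, neg_mul, neg_neg]; group
  rw [← h1] at h2
  have h3 := mul_left_cancel (mul_right_cancel h2)
  rw [← h3, hxi, mul_neg, neg_neg]

end GroupWords

/-! ### Unit quaternions. -/

namespace Quaternion

theorem mem_unitary_iff_norm_eq_one {q : ℍ[ℝ]} : q ∈ unitary ℍ[ℝ] ↔ ‖q‖ = 1 := by
  rw [Unitary.mem_iff, star_mul_self, self_mul_star, and_self, normSq_eq_norm_mul_self,
    ← Quaternion.coe_one, coe_inj, ← pow_two, sq_eq_one_iff]
  refine or_iff_left fun h => ?_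
  linarith [norm_nonneg q]

theorem mem_unitary_iff {q : ℍ[ℝ]} :
    q ∈ unitary ℍ[ℝ] ↔ q.re ^ 2 + q.imI ^ 2 + q.imJ ^ 2 + q.imK ^ 2 = 1 := by
  rw [Unitary.mem_iff, star_mul_self, self_mul_star, and_self, normSq_def',
    ← Quaternion.coe_one, coe_inj]

theorem unitary_ext {q r : unitary ℍ[ℝ]} (h0 : (q : ℍ[ℝ]).re = (r : ℍ[ℝ]).re)
    (h1 : (q : ℍ[ℝ]).imI = (r : ℍ[ℝ]).imI) (h2 : (q : ℍ[ℝ]).imJ = (r : ℍ[ℝ]).imJ)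
    (h3 : (q : ℍ[ℝ]).imK = (r : ℍ[ℝ]).imK) : q = r :=
  Subtype.ext (Quaternion.ext _ _ h0 h1 h2 h3)

theorem exists_unitary_components (t x y z : ℝ) (h : t ^ 2 + x ^ 2 + y ^ 2 + z ^ 2 = 1) :
    ∃ q : unitary ℍ[ℝ], (q : ℍ[ℝ]).re = t ∧ (q : ℍ[ℝ]).imI = x ∧ (q : ℍ[ℝ]).imJ = y ∧
      (q : ℍ[ℝ]).imK = z :=
  ⟨⟨⟨t, x, y, z⟩, mem_unitary_iff.2 h⟩, rfl, rfl, rfl, rfl⟩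

theorem unitary_mul_self_eq_neg_one {q : unitary ℍ[ℝ]} (h : (q : ℍ[ℝ]).re = 0) : q * q = -1 := by
  have h1 : star (q : ℍ[ℝ]) = -q := star_eq_neg.2 h
  apply Subtype.ext
  have h2 := Unitary.coe_mul_star_self q
  rw [Unitary.coe_star, h1, mul_neg] at h2
  rw [Unitary.coe_neg]
  exact neg_eq_iff_eq_neg.1 h2

theorem unitary_inv_eq_neg {q : unitary ℍ[ℝ]} (h : (q : ℍ[ℝ]).re = 0) : q⁻¹ = -q := by
  rw [inv_eq_iff_mul_eq_one, mul_neg, unitary_mul_self_eq_neg_one h, neg_neg]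

/-- The unitary quaternions `i` and `j`. -/
theorem exists_unitary_units : ∃ i j : unitary ℍ[ℝ],
    ((i : ℍ[ℝ]).re = 0 ∧ (i : ℍ[ℝ]).imI = 1 ∧ (i : ℍ[ℝ]).imJ = 0 ∧ (i : ℍ[ℝ]).imK = 0) ∧
      ((j : ℍ[ℝ]).re = 0 ∧ (j : ℍ[ℝ]).imI = 0 ∧ (j : ℍ[ℝ]).imJ = 1 ∧ (j : ℍ[ℝ]).imK = 0) := by
  obtain ⟨i, hi⟩ := exists_unitary_components 0 1 0 0 (by norm_num)
  obtain ⟨j, hj⟩ := exists_unitary_components 0 0 1 0 (by norm_num)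
  exact ⟨i, j, hi, hj⟩

theorem unitary_eq_one_or_neg_one_of_re {q : unitary ℍ[ℝ]} (h1 : (q : ℍ[ℝ]).imI = 0)
    (h2 : (q : ℍ[ℝ]).imJ = 0) (h3 : (q : ℍ[ℝ]).imK = 0) : q = 1 ∨ q = -1 := by
  have h := mem_unitary_iff.1 q.2
  rw [h1, h2, h3] at h
  have h0 : (q : ℍ[ℝ]).re = 1 ∨ (q : ℍ[ℝ]).re = -1 := sq_eq_one_iff.1 (by linarith)
  refine h0.imp (fun h0 => ?_) fun h0 => ?_ <;>
    apply unitary_ext <;> simp [h0, h1, h2, h3, Unitary.coe_neg]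

/-- A unitary quaternion that commutes with all square roots of `-1` is `1` or `-1`. -/
theorem unitary_eq_one_or_neg_one_of_commute {q : unitary ℍ[ℝ]}
    (h : ∀ x : unitary ℍ[ℝ], (x : ℍ[ℝ]).re = 0 → q * x = x * q) : q = 1 ∨ q = -1 := by
  -- Commuting with `i` kills the `j` and `k` components, commuting with `j` the `i` component.
  obtain ⟨i, j, ⟨i0, i1, i2, i3⟩, ⟨j0, j1, j2, j3⟩⟩ := exists_unitary_units
  have hi := congrArg Subtype.val (h i i0)
  have hj := congrArg Subtype.val (h j j0)
  have e1 := congrArg QuaternionAlgebra.imJ hi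
  have e2 := congrArg QuaternionAlgebra.imK hi
  have e3 := congrArg QuaternionAlgebra.imK hj
  simp [i0, i1, i2, i3] at e1 e2
  simp [j0, j1, j2, j3] at e3
  exact unitary_eq_one_or_neg_one_of_re (by linarith) (by linarith) (by linarith)

theorem exists_imaginary_decomposition (q : ℍ[ℝ]) :
    ∃ (p r : ℝ) (ζ : unitary ℍ[ℝ]), (ζ : ℍ[ℝ]).re = 0 ∧ q = p • 1 + r • (ζ : ℍ[ℝ]) := by
  by_cases h : q.im = 0
  · obtain ⟨i, -, ⟨i0, -⟩, -⟩ := exists_unitary_units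
    refine ⟨q.re, 0, i, i0, ?_⟩
    conv_lhs => rw [← q.re_add_im, h]
    rw [zero_smul]
    congr 1
    exact Algebra.algebraMap_eq_smul_one q.re
  · have hn : ‖q.im‖ ≠ 0 := norm_ne_zero_iff.2 h
    refine ⟨q.re, ‖q.im‖, ⟨‖q.im‖⁻¹ • q.im, mem_unitary_iff_norm_eq_one.2 ?_⟩, ?_, ?_⟩
    · simp [norm_smul, hn]
    · simp
    · conv_lhs => rw [← q.re_add_im]
      rw [smul_smul, mul_inv_cancel₀ hn, one_smul]
      congr 1
      exact Algebra.algebraMap_eq_smul_one q.re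

/-- The imaginary part of `nζ + ζn` is `2 n.re ζ`. -/
theorem re_eq_zero_of_anticommute {n ζ : ℍ[ℝ]} (hζ : ζ ≠ 0) (hζ0 : ζ.re = 0)
    (h : n * ζ = -(ζ * n)) : n.re = 0 := by
  by_contra hn
  have e1 := congrArg QuaternionAlgebra.imI h
  have e2 := congrArg QuaternionAlgebra.imJ h
  have e3 := congrArg QuaternionAlgebra.imK h
  simp [hζ0] at e1 e2 e3
  apply hζ
  have f1 : n.re * ζ.imI = 0 := by linarith
  have f2 : n.re * ζ.imJ = 0 := by linarith
  have f3 : n.re * ζ.imK = 0 := by linarith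
  simp [hn] at f1 f2 f3
  exact Quaternion.ext _ _ hζ0 f1 f2 f3

/-- Conjugation by an invertible such `n` is the nontrivial automorphism of the plane `ℝ[ζ]`. -/
theorem mul_eq_star_mul_of_anticommute {n ζ : ℍ[ℝ]} (hζ0 : ζ.re = 0)
    (h : n * ζ = -(ζ * n)) (p r : ℝ) : n * (p • 1 + r • ζ) = star (p • 1 + r • ζ) * n := by
  have : star ζ = -ζ := star_eq_neg.2 hζ0
  simp [mul_add, add_mul, h, this]

end Quaternion

/-! ### Admissible parameters in the four families. -/

namespace Quaternion

/-- If the product `x̄ a y b`, with `a` in the span of `1` and `i`, satisfies `(x², x², x) = 0`, then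
`b = ±1`, and `a = ±1` or `a` is imaginary. -/
theorem eq_one_or_re_eq_zero_of_star_left (a b : unitary ℍ[ℝ])
    (hJ : (a : ℍ[ℝ]).imJ = 0) (hK : (a : ℍ[ℝ]).imK = 0)
    (H : ∀ x : unitary ℍ[ℝ], ((x⁻¹ * a * x * b)⁻¹ * a * (x⁻¹ * a * x * b) * b)⁻¹ * a * x * b =
      (x⁻¹ * a * x * b)⁻¹ * a * ((x⁻¹ * a * x * b)⁻¹ * a * x * b) * b) :
    (b = 1 ∨ b = -1) ∧ ((a = 1 ∨ a = -1) ∨ (a : ℍ[ℝ]).re = 0) := by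
  have hab : b * a = a * b := commute_of_star_left_word (by simpa using H 1)
  by_cases hI : (a : ℍ[ℝ]).imI = 0
  · have ha := unitary_eq_one_or_neg_one_of_re hI hJ hK
    refine ⟨unitary_eq_one_or_neg_one_of_commute fun x _ => ?_, Or.inl ha⟩
    have h := H x
    have h' : b⁻¹ * x * b = b⁻¹ * b⁻¹ * x * b * b := by
      rcases ha with rfl | rfl <;> simpa [mul_assoc] using h
    calc b * x = b * b * (b⁻¹ * x * b) * b⁻¹ := by group
      _ = x * b := by rw [h']; group
  have hnorm := mem_unitary_iff.1 a.2
  rw [hJ, hK] at hnorm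
  have hb : (b : ℍ[ℝ]).imJ = 0 ∧ (b : ℍ[ℝ]).imK = 0 := by
    have h := congrArg Subtype.val hab
    have e1 := congrArg QuaternionAlgebra.imJ h
    have e2 := congrArg QuaternionAlgebra.imK h
    simp [hJ, hK] at e1 e2
    have f1 : (a : ℍ[ℝ]).imI * (b : ℍ[ℝ]).imK = 0 := by linarith
    have f2 : (a : ℍ[ℝ]).imI * (b : ℍ[ℝ]).imJ = 0 := by linarith
    simp [hI] at f1 f2
    exact ⟨f2, f1⟩
  obtain ⟨-, j, -, j0, j1, j2, j3⟩ := exists_unitary_units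
  have hj : ∀ q : unitary ℍ[ℝ], (q : ℍ[ℝ]).imJ = 0 → (q : ℍ[ℝ]).imK = 0 → j * q = q⁻¹ * j := by
    intro q h2 h3
    change j * q = star q * j
    apply unitary_ext <;> simp [j0, j1, j2, j3, h2, h3]
  have hbb := mul_self_eq_of_star_left_word hab (hj a hJ hK) (hj b hb.1 hb.2) (H j)
  -- The commuting elements `b` and `a²` have the same square.
  have hba : b = a * a ∨ b = -(a * a) := by
    have : (b : ℍ[ℝ]) = a * a ∨ (b : ℍ[ℝ]) = -(a * a) := by
      apply (Commute.mul_self_eq_mul_self_iff ?_).1 (congrArg Subtype.val hbb)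
      have : Commute b a := hab
      exact congrArg Subtype.val (this.mul_right this)
    exact this.imp Subtype.ext Subtype.ext
  -- With `x = (1 + j)/√2`, conjugation is a quarter turn about `j` that carries `a = c + s i` to `w
  -- = c + s k`.
  obtain ⟨r, hr⟩ : ∃ r : ℝ, r ^ 2 = 1 / 2 := ⟨Real.sqrt (1 / 2), Real.sq_sqrt (by norm_num)⟩
  obtain ⟨x, x0, x1, x2, x3⟩ := exists_unitary_components r 0 r 0 (by linarith)
  obtain ⟨w, w0, w1, w2, w3⟩ := exists_unitary_components (a : ℍ[ℝ]).re 0 0 (a : ℍ[ℝ]).imI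
    (by linarith)
  have hxw : a * x = x * w := by
    apply unitary_ext <;> simp [x0, x1, x2, x3, w0, w1, w2, w3, hJ, hK] <;> ring
  have hxa : x * a = w⁻¹ * x := by
    change x * a = star w * x
    apply unitary_ext <;> simp [x0, x1, x2, x3, w0, w1, w2, w3, hJ, hK] <;> ring
  have hxa2 : x * (a * a) * x⁻¹ = w⁻¹ * w⁻¹ := by
    rw [← mul_assoc, hxa, mul_assoc w⁻¹, hxa]; group
  have h := rotation_eq_of_star_left_word (w := w)
    (by rw [mul_assoc, hxw, inv_mul_cancel_left]) (H x)
  -- The sign in `b = ±a²` cancels, as `b` occurs twice on each side.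
  have h' : (a⁻¹ * a⁻¹) * ((w⁻¹ * a⁻¹) * (w * (a * a * a))) =
      (w⁻¹ * a⁻¹) * ((w⁻¹ * a) * (w⁻¹ * w⁻¹)) := by
    rw [← hxa2]
    rcases hba with rfl | rfl
    · calc _ = (a * a)⁻¹ * w⁻¹ * a⁻¹ * w * (a * a) * a := by group
        _ = _ := by rw [h]; group
    · calc _ = (-(a * a))⁻¹ * w⁻¹ * a⁻¹ * w * (-(a * a)) * a := by
            simp only [inv_neg, mul_neg, neg_mul, neg_neg]; group
        _ = _ := by rw [h]; simp only [inv_neg, mul_neg, neg_mul, neg_neg]; group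
  have h3 := congrArg QuaternionAlgebra.re (congrArg Subtype.val h')
  change ((star (a : ℍ[ℝ]) * star (a : ℍ[ℝ])) * ((star (w : ℍ[ℝ]) * star (a : ℍ[ℝ])) *
    (w * (a * a * a)))).re = ((star (w : ℍ[ℝ]) * star (a : ℍ[ℝ])) * ((star (w : ℍ[ℝ]) * a) *
      (star (w : ℍ[ℝ]) * star (w : ℍ[ℝ])))).re at h3
  simp only [re_mul, imI_mul, imJ_mul, imK_mul, re_star, imI_star, imJ_star, imK_star, w0, w1, w2,
    w3, hJ, hK] at h3
  -- Modulo `c² + s² = 1`, the two real parts differ by `8 s² c⁴`; since `s ≠ 0`, this forces `c =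
  -- 0`.
  have key : 8 * (a : ℍ[ℝ]).imI ^ 2 * (a : ℍ[ℝ]).re ^ 4 = 0 := by
    generalize (a : ℍ[ℝ]).re = c at *
    generalize (a : ℍ[ℝ]).imI = s at *
    linear_combination h3 -
      (8 * s ^ 2 * c ^ 4 + (c ^ 4 + s ^ 4) * (c ^ 2 - s ^ 2) - 4 * c ^ 4 * s ^ 2) * hnorm
  have hc : (a : ℍ[ℝ]).re = 0 := by simpa [hI] using key
  rw [unitary_mul_self_eq_neg_one hc, neg_neg] at hba
  exact ⟨hba.symm, Or.inr hc⟩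

/-- If the product `a x y b` satisfies `(x², x², x) = 0`, then `a = ±1` and `b = ±1`. -/
theorem eq_one_or_neg_one_of_left_right (a b : unitary ℍ[ℝ])
    (H : ∀ x : unitary ℍ[ℝ], a * (a * (a * x * x * b) * (a * x * x * b) * b) * x * b =
      a * (a * x * x * b) * (a * (a * x * x * b) * x * b) * b) :
    (a = 1 ∨ a = -1) ∧ (b = 1 ∨ b = -1) := by
  have hab : a * b = b * a := by
    have h := H 1
    simp only [mul_one] at h
    calc a * b = a⁻¹ * a⁻¹ * (a * (a * (a * b) * (a * b) * b) * b) * b⁻¹ * b⁻¹ * b⁻¹ * a⁻¹ := by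
          group
      _ = b * a := by rw [h]; group
  have hb : b = 1 ∨ b = -1 := by
    refine unitary_eq_one_or_neg_one_of_commute fun x hx => ?_
    have h := H x
    have hu : a * x * x * b = -(a * b) := by
      rw [mul_assoc a, unitary_mul_self_eq_neg_one hx]; simp
    simp only [hu, mul_neg, neg_mul, neg_neg] at h
    calc b * x = b⁻¹ * a⁻¹ * (b⁻¹ * a⁻¹) * a⁻¹ * a⁻¹ *
          (a * (a * (a * b) * (a * b) * b) * x * b) * b⁻¹ := by group
      _ = b⁻¹ * a⁻¹ * (b⁻¹ * a⁻¹) * (b * a) * (a * b) * x * b := by rw [h]; group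
      _ = x * b := by rw [← hab]; group
  refine ⟨unitary_eq_one_or_neg_one_of_commute fun v hv => ?_, hb⟩
  obtain ⟨r, hr⟩ : ∃ r : ℝ, r ^ 2 = 1 / 2 := ⟨Real.sqrt (1 / 2), Real.sq_sqrt (by norm_num)⟩
  have hnorm := mem_unitary_iff.1 v.2
  rw [hv] at hnorm
  -- `x = (1 + v)/√2` is a square root of the imaginary unit `v`.
  obtain ⟨x, x0, x1, x2, x3⟩ := exists_unitary_components r (r * (v : ℍ[ℝ]).imI)
    (r * (v : ℍ[ℝ]).imJ) (r * (v : ℍ[ℝ]).imK) (by linear_combination hr + r ^ 2 * hnorm + hr)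
  have hxx : x * x = v := by
    apply unitary_ext <;> simp [x0, x1, x2, x3, hv]
    · linear_combination -r ^ 2 * hnorm
    · linear_combination 2 * (v : ℍ[ℝ]).imI * hr
    · linear_combination 2 * (v : ℍ[ℝ]).imJ * hr
    · linear_combination 2 * (v : ℍ[ℝ]).imK * hr
  have h := H x
  rw [mul_assoc a x x, hxx] at h
  have h' : a * (a * (a * v) * (a * v)) * x = a * (a * v) * (a * (a * v) * x) := by
    rcases hb with rfl | rfl <;> simpa using h
  calc a * v = a⁻¹ * a⁻¹ * (a * (a * (a * v) * (a * v)) * x) * x⁻¹ * v⁻¹ * a⁻¹ := by group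
    _ = v * a := by rw [h']; group

/-- The product `a x b ȳ` never satisfies `(x², x², x) = 0`. -/
theorem not_forall_of_right_star (a b : unitary ℍ[ℝ])
    (H : ∀ x : unitary ℍ[ℝ],
      a * (a * (a * x * b * x⁻¹) * b * (a * x * b * x⁻¹)⁻¹) * b * x⁻¹ =
        a * (a * x * b * x⁻¹) * b * (a * (a * x * b * x⁻¹) * b * x⁻¹)⁻¹) : False := by
  have h1 := word_eq_one_of_star_right_word (a := a) (b := b) (by simpa using H 1)
  -- Take an imaginary unit `ζ` with `b ∈ ℝ[ζ]`. Testing at `ζ` shows that `a²` anticommutes with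
  -- `ζ`, so `a²` is imaginary and inverts `b`. Testing at `a²` then gives `(a²)² = 1`, against
  -- `(a²)² = -1`.
  obtain ⟨p, r, ζ, hζ, hb⟩ := exists_imaginary_decomposition b
  have hζb : ζ * b = b * ζ := by
    apply Subtype.ext
    change (ζ : ℍ[ℝ]) * b = b * ζ
    rw [hb]
    simp [mul_add, add_mul]
  have h2 := inv_eq_conj_of_star_right_word hζb h1 (H ζ)
  rw [eq_mul_inv_iff_mul_eq, unitary_inv_eq_neg hζ, neg_mul] at h2
  have h3 : ((a * a : unitary ℍ[ℝ]) : ℍ[ℝ]) * ζ = -(ζ * (a * a : unitary ℍ[ℝ])) :=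
    congrArg Subtype.val h2.symm
  have hn := re_eq_zero_of_anticommute (Unitary.isUnit_coe (U := ζ)).ne_zero hζ h3
  have h4 : a * a * b = b⁻¹ * (a * a) := by
    apply Subtype.ext
    change ((a * a : unitary ℍ[ℝ]) : ℍ[ℝ]) * b = star (b : ℍ[ℝ]) * (a * a : unitary ℍ[ℝ])
    rw [hb]
    exact mul_eq_star_mul_of_anticommute hζ h3 p r
  have h5 := mul_self_inv_eq_of_star_right_word h4 h1 (H (a * a))
  have h6 := unitary_mul_self_eq_neg_one hn
  rw [inv_eq_iff_mul_eq_one, h6] at h5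
  have h7 := congrArg (fun q : unitary ℍ[ℝ] => (q : ℍ[ℝ]).re) h5
  simp [Unitary.coe_neg] at h7
  norm_num at h7

/-- The product `a x̄ ȳ b` never satisfies `(x², x², x) = 0`. -/
theorem not_forall_of_star_star (a b : unitary ℍ[ℝ])
    (H : ∀ x : unitary ℍ[ℝ],
      a * (a * (a * x⁻¹ * x⁻¹ * b)⁻¹ * (a * x⁻¹ * x⁻¹ * b)⁻¹ * b)⁻¹ * x⁻¹ * b =
        a * (a * x⁻¹ * x⁻¹ * b)⁻¹ * (a * (a * x⁻¹ * x⁻¹ * b)⁻¹ * x⁻¹ * b)⁻¹ * b) : False := by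
  have h1 := mul_eq_inv_mul_inv_of_star_star_word (a := a) (b := b) (by simpa using H 1)
  have h2 : ∀ x : unitary ℍ[ℝ], (x : ℍ[ℝ]).re = 0 → a * b * a⁻¹ * x = -(x * (a * b * a⁻¹)) :=
    fun x hx => anticommute_of_star_star_word (unitary_mul_self_eq_neg_one hx) h1 (H x)
  generalize a * b * a⁻¹ = v at h2
  obtain ⟨i, j, ⟨i0, i1, i2, i3⟩, ⟨j0, j1, j2, j3⟩⟩ := exists_unitary_units
  -- Anticommuting with `i` and `j` makes `v` commute with `ij`, which is itself imaginary and must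
  -- anticommute with `v`.
  have h3 := h2 (i * j) (by simp [i0, i1, i2, i3, j0, j1, j2, j3])
  have h4 : v * (i * j) = i * j * v := by
    rw [← mul_assoc, h2 i i0, neg_mul, mul_assoc, h2 j j0, mul_neg, neg_neg, mul_assoc]
  rw [h4] at h3
  have h5 := congrArg Subtype.val h3
  rw [Unitary.coe_neg, eq_neg_iff_add_eq_zero, ← two_smul ℝ, smul_eq_zero] at h5
  exact (Unitary.isUnit_coe (U := i * j * v)).ne_zero (h5.resolve_left two_ne_zero)

end Quaternion

/-! ### The identity in the three models. -/

theorem AlgIsomorphic.of_linearEquiv {A B : Type*} [NonUnitalNonAssocRing A] [Module ℝ A]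
    [NonUnitalNonAssocRing B] [Module ℝ B] (e : A ≃ₗ[ℝ] B) (h : ∀ x y, e (x * y) = e x * e y) :
    AlgIsomorphic A B :=
  ⟨{ toFun := e, map_smul' := e.map_smul, map_zero' := e.map_zero, map_add' := e.map_add,
      map_mul' := h }, e.bijective⟩

theorem AlgIsomorphic.associator_sq_sq_eq_zero {A B : Type*} [NonUnitalNonAssocRing A] [Module ℝ A]
    [NonUnitalNonAssocRing B] [Module ℝ B] (h : AlgIsomorphic A B)
    (hB : ∀ x : B, associator (x * x) (x * x) x = 0) (x : A) :
    associator (x * x) (x * x) x = 0 := by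
  obtain ⟨f, hf⟩ := h
  apply hf.1
  have := hB (f x)
  simpa only [associator_apply, map_sub, map_mul, map_zero] using this

/-- As `x̄x` is self-conjugate, both products expand to `x̄ x x̄ x x`. -/
theorem StarQuaternion.associator_sq_sq_eq_zero (x : StarQuaternion) :
    associator (x * x) (x * x) x = 0 := by
  rw [associator_apply, sub_eq_zero]
  apply StarIsotope.toQuaternion.injective
  simp only [StarQuaternion.toQuaternion_mul, star_mul, star_star, mul_assoc]

/-- The square `u = x̄ i x` is imaginary like `i`, so conjugation only changes signs and both
products equal `u i u i x`. -/
theorem StarIsotope.associator_sq_sq_eq_zero_of_quaternionI (x : StarIsotope quaternionI 1) :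
    associator (x * x) (x * x) x = 0 := by
  have h : star quaternionI = -quaternionI := Quaternion.star_eq_neg.2 rfl
  rw [associator_apply, sub_eq_zero]
  apply StarIsotope.toQuaternion.injective
  simp only [StarIsotope.toQuaternion_mul, star_mul, star_star, mul_one, h, mul_assoc, neg_mul,
    mul_neg, neg_neg, star_neg]

/-! ### Reduction of an isotope to its family. -/

namespace Quaternion

/-- Every unit quaternion is conjugate to one in the span of `1` and `i`. -/
theorem exists_conj_mem_span (a : unitary ℍ[ℝ]) : ∃ κ : unitary ℍ[ℝ],
    ((κ⁻¹ * a * κ : unitary ℍ[ℝ]) : ℍ[ℝ]).imJ = 0 ∧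
      ((κ⁻¹ * a * κ : unitary ℍ[ℝ]) : ℍ[ℝ]).imK = 0 := by
  obtain ⟨p, r, ζ, hζ, ha⟩ := exists_imaginary_decomposition a
  obtain ⟨i, j, ⟨i0, i1, i2, i3⟩, ⟨j0, j1, j2, j3⟩⟩ := exists_unitary_units
  -- `ζi - 1` intertwines `ζ` and `i`, both sides being `-ζ - i`. It vanishes only for `ζ = -i`,
  -- where `j` serves.
  obtain ⟨κ, hκ⟩ : ∃ κ : unitary ℍ[ℝ], ζ * κ = κ * i := by
    by_cases h : (ζ : ℍ[ℝ]) * i - 1 = 0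
    · have h1 : ζ * i = 1 := Subtype.ext (sub_eq_zero.1 h)
      have h2 : ζ = -i := by rw [eq_inv_of_mul_eq_one_left h1, unitary_inv_eq_neg i0]
      refine ⟨j, ?_⟩
      rw [h2]
      apply unitary_ext <;> simp [i0, i1, i2, i3, j0, j1, j2, j3, Unitary.coe_neg]
    · have hn : ‖(ζ : ℍ[ℝ]) * i - 1‖ ≠ 0 := norm_ne_zero_iff.2 h
      refine ⟨⟨‖(ζ : ℍ[ℝ]) * i - 1‖⁻¹ • ((ζ : ℍ[ℝ]) * i - 1), mem_unitary_iff_norm_eq_one.2 ?_⟩, ?_⟩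
      · rw [norm_smul, norm_inv, norm_norm, inv_mul_cancel₀ hn]
      · apply Subtype.ext
        have e1 : (ζ : ℍ[ℝ]) * ζ = -1 := congrArg Subtype.val (unitary_mul_self_eq_neg_one hζ)
        have e2 : (i : ℍ[ℝ]) * i = -1 := congrArg Subtype.val (unitary_mul_self_eq_neg_one i0)
        change (ζ : ℍ[ℝ]) * (‖(ζ : ℍ[ℝ]) * i - 1‖⁻¹ • ((ζ : ℍ[ℝ]) * i - 1)) =
          (‖(ζ : ℍ[ℝ]) * i - 1‖⁻¹ • ((ζ : ℍ[ℝ]) * i - 1)) * i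
        rw [mul_smul_comm, smul_mul_assoc, mul_sub, sub_mul, ← mul_assoc, e1, mul_assoc, e2]
        congr 1
        simp only [neg_mul, one_mul, mul_neg, mul_one]
        abel
  have h : ((κ⁻¹ * a * κ : unitary ℍ[ℝ]) : ℍ[ℝ]) = p • 1 + r • (i : ℍ[ℝ]) := by
    have h1 : (ζ : ℍ[ℝ]) * κ = κ * i := congrArg Subtype.val hκ
    have h2 : star (κ : ℍ[ℝ]) * κ = 1 := Unitary.coe_star_mul_self κ
    change star (κ : ℍ[ℝ]) * a * κ = _
    rw [ha, mul_assoc, add_mul, smul_mul_assoc, smul_mul_assoc, one_mul, h1, mul_add, mul_smul_comm,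
      mul_smul_comm, ← mul_assoc, h2, one_mul]
  refine ⟨κ, ?_, ?_⟩ <;> rw [h] <;> simp [i2, i3]

section Isotopes

variable {A : Type*} [NonUnitalNonAssocRing A] [Module ℝ A]

theorem unitary_coe_inv (u : unitary ℍ[ℝ]) : ((u⁻¹ : unitary ℍ[ℝ]) : ℍ[ℝ]) = star (u : ℍ[ℝ]) :=
  rfl

theorem star_mul_cancel_left (u : unitary ℍ[ℝ]) (x : ℍ[ℝ]) : star (u : ℍ[ℝ]) * (u * x) = x := by
  rw [← mul_assoc, Unitary.coe_star_mul_self, one_mul]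

theorem mul_star_cancel_left (u : unitary ℍ[ℝ]) (x : ℍ[ℝ]) : u * (star (u : ℍ[ℝ]) * x) = x := by
  rw [← mul_assoc]
  exact (congrArg (· * x) (Unitary.coe_mul_star_self u)).trans (one_mul x)

theorem mul_star_self_of_unitary (u : unitary ℍ[ℝ]) : u * star (u : ℍ[ℝ]) = 1 :=
  Unitary.coe_mul_star_self u

/-- A change of coordinates that moves unit factors through the product until only the parameters of
the family remain. -/
theorem exists_linearEquiv_mul_mul (F : A ≃ₗ[ℝ] ℍ[ℝ]) (c d : unitary ℍ[ℝ]) :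
    ∃ G : A ≃ₗ[ℝ] ℍ[ℝ], (∀ x, F x = c * G x * d) ∧
      ∀ x, G x = star (c : ℍ[ℝ]) * F x * star (d : ℍ[ℝ]) :=
  ⟨F.trans
    { toFun := fun x => star (c : ℍ[ℝ]) * x * star (d : ℍ[ℝ])
      map_add' := fun x y => by rw [mul_add, add_mul]
      map_smul' := fun t x => by simp only [mul_smul_comm, smul_mul_assoc, RingHom.id_apply]
      invFun := fun x => c * x * d
      left_inv := fun x => by
        simp only [mul_assoc, mul_star_cancel_left, Unitary.coe_star_mul_self, mul_one]
      right_inv := fun x => by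
        simp only [mul_assoc, star_mul_cancel_left, mul_star_self_of_unitary, mul_one] },
    fun x => by simp [mul_assoc, mul_star_cancel_left], fun x => rfl⟩

theorem map_sq_mul_sq_mul (hid : ∀ x : A, associator (x * x) (x * x) x = 0) (F : A ≃ₗ[ℝ] ℍ[ℝ])
    (x : ℍ[ℝ]) :
    F ((F.symm x * F.symm x) * (F.symm x * F.symm x) * F.symm x) =
      F ((F.symm x * F.symm x) * ((F.symm x * F.symm x) * F.symm x)) :=
  congrArg F (sub_eq_zero.1 (hid (F.symm x)))

theorem algIsomorphic_of_mul_mul (hid : ∀ x : A, associator (x * x) (x * x) x = 0)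
    (F : A ≃ₗ[ℝ] ℍ[ℝ]) (p q r s : unitary ℍ[ℝ])
    (hF : ∀ x y, F (x * y) = p * F x * q * (r * F y * s)) : AlgIsomorphic A ℍ[ℝ] := by
  obtain ⟨G, hFG, hGF⟩ := exists_linearEquiv_mul_mul F 1 (q * r)⁻¹
  obtain ⟨b, hb⟩ : ∃ b, b = r⁻¹ * q⁻¹ * s * q * r := ⟨_, rfl⟩
  have hG : ∀ x y, G (x * y) = p * G x * G y * b := fun x y => by
    rw [hGF, hF, hFG, hFG, hb]
    simp [unitary_coe_inv, mul_assoc, star_mul_cancel_left]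
  obtain ⟨hp, hb⟩ := eq_one_or_neg_one_of_left_right p b fun x => by
    have h := map_sq_mul_sq_mul hid G x
    simp only [hG, LinearEquiv.apply_symm_apply] at h
    exact Subtype.ext h
  -- The product now carries a sign `pb = ±1`, which rescaling by that sign removes.
  obtain ⟨K, hGK, hKG⟩ := exists_linearEquiv_mul_mul G (p * b) 1
  refine AlgIsomorphic.of_linearEquiv K fun x y => ?_
  rw [hKG, hG, hGK, hGK]
  rcases hp with rfl | rfl <;> rcases hb with rfl | rfl <;> simp [Unitary.coe_neg]

theorem algIsomorphic_of_star_mul (hid : ∀ x : A, associator (x * x) (x * x) x = 0)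
    (F : A ≃ₗ[ℝ] ℍ[ℝ]) (p q r s : unitary ℍ[ℝ])
    (hF : ∀ x y, F (x * y) = p * star (F x) * q * (r * F y * s)) :
    AlgIsomorphic A StarQuaternion ∨ AlgIsomorphic A (StarIsotope quaternionI 1) := by
  -- Cancelling the outer `p` leaves the middle factor `p⁻¹qrp`; a common conjugation by `κ`
  -- preserves the shape `x̄ a y b` and puts `a` in the span of `1` and `i`.
  obtain ⟨κ, hJ, hK⟩ := exists_conj_mem_span (p⁻¹ * q * r * p)
  obtain ⟨a, ha⟩ : ∃ a, a = κ⁻¹ * (p⁻¹ * q * r * p) * κ := ⟨_, rfl⟩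
  obtain ⟨b, hb⟩ : ∃ b, b = κ⁻¹ * s * κ := ⟨_, rfl⟩
  rw [← ha] at hJ hK
  obtain ⟨G, hFG, hGF⟩ := exists_linearEquiv_mul_mul F (p * κ) κ⁻¹
  have hG : ∀ x y, G (x * y) = star (G x) * a * G y * b := fun x y => by
    rw [hGF, hF, hFG, hFG, ha, hb]
    simp [unitary_coe_inv, mul_assoc, star_mul_cancel_left]
  obtain ⟨hb, ha⟩ := eq_one_or_re_eq_zero_of_star_left a b hJ hK fun x => by
    have h := map_sq_mul_sq_mul hid G x
    simp only [hG, LinearEquiv.apply_symm_apply] at h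
    exact Subtype.ext h
  rcases ha with ha | h0
  · left
    obtain ⟨K, hGK, hKG⟩ := exists_linearEquiv_mul_mul G (a * b) 1
    refine AlgIsomorphic.of_linearEquiv (K.trans StarIsotope.toQuaternion.symm) fun x y => ?_
    apply StarIsotope.toQuaternion.injective
    simp only [StarQuaternion.toQuaternion_mul, LinearEquiv.trans_apply,
      LinearEquiv.apply_symm_apply]
    rw [hKG, hG, hGK, hGK]
    rcases ha with rfl | rfl <;> rcases hb with rfl | rfl <;> simp [Unitary.coe_neg]
  · right
    have hI : (a : ℍ[ℝ]).imI = 1 ∨ (a : ℍ[ℝ]).imI = -1 := by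
      have := mem_unitary_iff.1 a.2
      rw [h0, hJ, hK] at this
      exact sq_eq_one_iff.1 (by linarith)
    have ha : ∃ δ : unitary ℍ[ℝ], (δ = 1 ∨ δ = -1) ∧ (a : ℍ[ℝ]) = δ * quaternionI := by
      have i0 : quaternionI.re = 0 := rfl
      have i1 : quaternionI.imI = 1 := rfl
      have i2 : quaternionI.imJ = 0 := rfl
      have i3 : quaternionI.imK = 0 := rfl
      rcases hI with hI | hI
      · refine ⟨1, Or.inl rfl, Quaternion.ext _ _ ?_ ?_ ?_ ?_⟩ <;> simp [h0, hI, hJ, hK, i0, i1, i2, i3]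
      · refine ⟨-1, Or.inr rfl, Quaternion.ext _ _ ?_ ?_ ?_ ?_⟩ <;>
          simp [Unitary.coe_neg, h0, hI, hJ, hK, i0, i1, i2, i3]
    obtain ⟨δ, hδ, ha⟩ := ha
    obtain ⟨K, hGK, hKG⟩ := exists_linearEquiv_mul_mul G (δ * b) 1
    refine AlgIsomorphic.of_linearEquiv (K.trans StarIsotope.toQuaternion.symm) fun x y => ?_
    apply StarIsotope.toQuaternion.injective
    simp only [StarIsotope.toQuaternion_mul, LinearEquiv.trans_apply,
      LinearEquiv.apply_symm_apply]
    rw [hKG, hG, hGK, hGK, ha]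
    rcases hδ with rfl | rfl <;> rcases hb with rfl | rfl <;> simp [Unitary.coe_neg]

theorem not_mul_star (hid : ∀ x : A, associator (x * x) (x * x) x = 0)
    (F : A ≃ₗ[ℝ] ℍ[ℝ]) (p q r s : unitary ℍ[ℝ])
    (hF : ∀ x y, F (x * y) = p * F x * q * (r * star (F y) * s)) : False := by
  obtain ⟨G, hFG, hGF⟩ := exists_linearEquiv_mul_mul F 1 s
  obtain ⟨b, hb⟩ : ∃ b, b = s * q * r * s⁻¹ := ⟨_, rfl⟩
  have hG : ∀ x y, G (x * y) = p * G x * b * star (G y) := fun x y => by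
    rw [hGF, hF, hFG, hFG, hb]
    simp [unitary_coe_inv, mul_assoc]
  refine not_forall_of_right_star p b fun x => ?_
  have h := map_sq_mul_sq_mul hid G x
  simp only [hG, LinearEquiv.apply_symm_apply] at h
  exact Subtype.ext h

theorem not_star_star (hid : ∀ x : A, associator (x * x) (x * x) x = 0)
    (F : A ≃ₗ[ℝ] ℍ[ℝ]) (p q r s : unitary ℍ[ℝ])
    (hF : ∀ x y, F (x * y) = p * star (F x) * q * (r * star (F y) * s)) : False := by
  obtain ⟨G, hFG, hGF⟩ := exists_linearEquiv_mul_mul F 1 (q * r)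
  obtain ⟨a, ha⟩ : ∃ a, a = p * (q * r)⁻¹ := ⟨_, rfl⟩
  obtain ⟨b, hb⟩ : ∃ b, b = s * (q * r)⁻¹ := ⟨_, rfl⟩
  have hG : ∀ x y, G (x * y) = a * star (G x) * star (G y) * b := fun x y => by
    rw [hGF, hF, hFG, hFG, ha, hb]
    simp [unitary_coe_inv, mul_assoc, mul_star_cancel_left]
  refine not_forall_of_star_star a b fun x => ?_
  have h := map_sq_mul_sq_mul hid G x
  simp only [hG, LinearEquiv.apply_symm_apply] at h
  exact Subtype.ext h

end Isotopes

end Quaternion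

theorem theorem3p16 (A : Type*) [NonUnitalNonAssocRing A] [Module ℝ A]
    [IsScalarTower ℝ A A] [SMulCommClass ℝ A A]
    [Norm A] (_hnorm : NormedSpace.Core ℝ A) [NormMulClass A]
    (_hdim : Module.finrank ℝ A = 4) :
    (∀ x : A, associator (x * x) (x * x) x = 0) ↔
      (AlgIsomorphic A ℍ[ℝ] ∨ AlgIsomorphic A StarQuaternion ∨
        AlgIsomorphic A (StarIsotope quaternionI 1)) := by
  constructor
  · intro hid
    obtain ⟨E, hE⟩ := exists_linearEquiv_quaternion_norm_mul _hnorm _hdim (LinearMap.mul ℝ A)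
      (fun x y => norm_mul x y)
    obtain ⟨f, g, F, hF⟩ := Quaternion.exists_linearEquiv_isotope (LinearMap.mul ℝ A) E
      (fun x y => by rw [hE, hE, hE]; exact norm_mul x y)
    replace hF : ∀ x y, F (x * y) = f (F x) * g (F y) := hF
    obtain ⟨p, q, hp, hq, hf⟩ := Quaternion.linearIsometryEquiv_eq_mul_mul f
    obtain ⟨r, s, hr, hs, hg⟩ := Quaternion.linearIsometryEquiv_eq_mul_mul g
    rw [← Quaternion.mem_unitary_iff_norm_eq_one] at hp hq hr hs
    lift p to unitary ℍ[ℝ] using hp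
    lift q to unitary ℍ[ℝ] using hq
    lift r to unitary ℍ[ℝ] using hr
    lift s to unitary ℍ[ℝ] using hs
    rcases hf with hf | hf <;> rcases hg with hg | hg <;> simp only [hf, hg] at hF
    · exact Or.inl (Quaternion.algIsomorphic_of_mul_mul hid F p q r s hF)
    · exact (Quaternion.not_mul_star hid F p q r s hF).elim
    · exact Or.inr (Quaternion.algIsomorphic_of_star_mul hid F p q r s hF)
    · exact (Quaternion.not_star_star hid F p q r s hF).elim
  · rintro (h | h | h)
    · exact h.associator_sq_sq_eq_zero fun x => by simp [associator_apply, mul_assoc]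
    · exact h.associator_sq_sq_eq_zero StarQuaternion.associator_sq_sq_eq_zero
    · exact h.associator_sq_sq_eq_zero StarIsotope.associator_sq_sq_eq_zero_of_quaternionI
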